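/- For finite-dimensional Hilbert spaces $\mathcal H^A,\mathcal H^B$, a state on $\mathcal H^A\otimes\mathcal H^B$ is a positive semidefinite operator of trace $1$; it is separable if it is a convex combination of projectors $|\psi\rangle\langle\psi|$ onto unit product vectors $|\psi\rangle=|\psi_A\rangle\otimes|\psi_B\rangle$. The trace distance of two states is $\|\rho-\sigma\|_{\mathrm{Tr}}=\tfrac12\mathrm{Tr}|\rho-\sigma|$, where $|X|=\sqrt{X^\dagger X}$. Let $C$ be a condition on bipartite states of arbitrary finite dimensions such that (i) every separable state satisfies $C$; (ii) some state that is not separable satisfies $C$; (iii) if $\rho$ on $\mathcal H^A\otimes\mathcal H^B$ and $\sigma$ on $\mathcal H^{A'}\otimes\mathcal H^{B'}$ satisfy $C$, then so does $\rho\otimes\sigma$, regarded as a bipartite state on $(\mathcal H^A\otimes\mathcal H^{A'})\otimes(\mathcal H^B\otimes\mathcal H^{B'})$. Then for every $\varepsilon>0$ there exist finite-dimensional $\mathcal H^A,\mathcal H^B$ and a state $\rho$ on $\mathcal H^A\otimes\mathcal H^B$ that satisfies $C$ and whose trace distance from the separable states is at least $1-\varepsilon$, i.e. $\|\rho-\sigma\|_{\mathrm{Tr}}\ge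 1-\varepsilon$ for every separable state $\sigma$ on $\mathcal H^A\otimes\mathcal H^B$. -/

import Mathlib

open scoped ComplexOrder MatrixOrder Matrix Kronecker

noncomputable section

/-- A density matrix (state) on the Hilbert space with orthonormal basis indexed by `ι`:
a positive semidefinite complex matrix of trace one. -/
def IsState {ι : Type} [Fintype ι] (ρ : Matrix ι ι ℂ) : Prop :=
  ρ.PosSemidef ∧ ρ.trace = 1

/-- The product vector `a ⊗ b` in `ℂ^A ⊗ ℂ^B = ℂ^(A × B)`. -/
def tensorVec {A B : Type} (a : A → ℂ) (b : B → ℂ) : A × B → ℂ :=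
  fun p => a p.1 * b p.2

/-- The projectors `|ψ⟩⟨ψ|` onto separable pure states: `ψ` is a unit vector which is
a product vector. -/
def pureSep (A B : Type) [Fintype A] [Fintype B] : Set (Matrix (A × B) (A × B) ℂ) :=
  {M | ∃ ψ : A × B → ℂ, star ψ ⬝ᵥ ψ = 1 ∧ (∃ (a : A → ℂ) (b : B → ℂ), ψ = tensorVec a b) ∧
    M = Matrix.vecMulVec ψ (star ψ)}

/-- The set of separable states: convex combinations of projectors onto separable pure states. -/
def SEP (A B : Type) [Fintype A] [Fintype B] : Set (Matrix (A × B) (A × B) ℂ) :=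
  convexHull ℝ (pureSep A B)

open Classical in
/-- The trace distance `(1/2) Tr |ρ - σ|`, where `|X| = √(Xᴴ X)`. -/
def traceDist {ι : Type} [Fintype ι] (ρ σ : Matrix ι ι ℂ) : ℝ :=
  (1 / 2) * (Matrix.trace (CFC.sqrt ((ρ - σ)ᴴ * (ρ - σ)))).re

/-- The tensor product of two bipartite states, as a bipartite state with respect to the cut
`(A ⊗ A') ⊗ (B ⊗ B')`. -/
def bipartiteTensor {A B A' B' : Type} (ρ : Matrix (A × B) (A × B) ℂ)
    (σ : Matrix (A' × B') (A' × B') ℂ) :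
    Matrix ((A × A') × (B × B')) ((A × A') × (B × B')) ℂ :=
  Matrix.reindex (Equiv.prodProdProdComm A B A' B') (Equiv.prodProdProdComm A B A' B') (ρ ⊗ₖ σ)

/-- A (not necessarily valid) test for separability: a condition on the bipartite matrices of all
finite dimensions, given as the set of the matrices which satisfy it. Only its values on states
matter. -/
def Criterion : Type 1 :=
  ∀ (A B : Type) [Fintype A] [Fintype B], Set (Matrix (A × B) (A × B) ℂ)

/-- The criterion is necessary for separability: every separable state satisfies it. -/
def Criterion.IsNecessary (C : Criterion) : Prop :=
  ∀ (A B : Type) [Fintype A] [Fintype B], SEP A B ⊆ C A B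

/-- The criterion is sufficient for separability: every state which satisfies it is separable. -/
def Criterion.IsSufficient (C : Criterion) : Prop :=
  ∀ (A B : Type) [Fintype A] [Fintype B] (ρ : Matrix (A × B) (A × B) ℂ),
    IsState ρ → ρ ∈ C A B → ρ ∈ SEP A B

/-- If the states `ρ` and `σ` satisfy the criterion, then so does `ρ ⊗ σ`. -/
def Criterion.IsTensorClosed (C : Criterion) : Prop :=
  ∀ (A B A' B' : Type) [Fintype A] [Fintype B] [Fintype A'] [Fintype B']
    (ρ : Matrix (A × B) (A × B) ℂ) (σ : Matrix (A' × B') (A' × B') ℂ),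
    IsState ρ → IsState σ → ρ ∈ C A B → σ ∈ C A' B' →
      bipartiteTensor ρ σ ∈ C (A × A') (B × B')

end

/-!
Let `ρ` be a state which satisfies the criterion and is not separable. Tensor powers of `ρ` satisfy
the criterion too, and their trace distance from the separable states tends to `1`.

To see this, measure each copy of `ρ` with an informationally complete measurement all of whose
elements are multiples of projectors onto product vectors (`polarMeasurement`). The trace distance
of two states is at least `1` minus the Bhattacharyya coefficient `∑ √(p x * q x)` of the outcome
distributions (`ProductMeasurement.one_sub_overlap_le_traceDist`). For one copy, this coefficient
is at most some `β < 1` on all separable states, since those form a compact set which does not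
contain `ρ` (`exists_distinguishes`). For `n` copies it is at most `β ^ n`: if a separable state
of several copies is measured in product vectors on some of them, the conditional state of the
others is again separable, so that the one-copy bound applies to each conditional distribution in
turn (`ProductMeasurement.Distinguishes.prod`). No assumption is needed on how the copies are
correlated in the separable state.
-/

/-! ### Compactness of convex hulls -/

/-- By Carathéodory's theorem the convex hull of `s` consists of the convex combinations of
`finrank ℝ E + 1` points of `s`, so it is a continuous image of a compact set. -/
theorem IsCompact.convexHull_of_finiteDimensional {E : Type*} [AddCommGroup E] [Module ℝ E]
    [TopologicalSpace E] [ContinuousAdd E] [ContinuousSMul ℝ E] [FiniteDimensional ℝ E]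
    {s : Set E} (hs : IsCompact s) : IsCompact (convexHull ℝ s) := by
  rcases s.eq_empty_or_nonempty with rfl | ⟨x₀, hx₀⟩
  · simp
  let ι := Fin (Module.finrank ℝ E + 1)
  have hc : IsCompact ((fun q : (ι → ℝ) × (ι → E) => ∑ i, q.1 i • q.2 i) ''
      (stdSimplex ℝ ι ×ˢ Set.univ.pi fun _ => s)) := by
    refine ((isCompact_stdSimplex ℝ ι).prod (isCompact_univ_pi fun _ => hs)).image ?_
    fun_prop
  convert hc using 1
  refine Set.Subset.antisymm (fun x hx => ?_) ?_
  · obtain ⟨κ, _, z, w, hz, hind, hw, hw1, rfl⟩ := eq_pos_convex_span_of_mem_convexHull hx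
    have hcard : Fintype.card κ ≤ Fintype.card ι := by
      rw [Fintype.card_fin]
      exact hind.card_le_finrank_succ.trans (Nat.succ_le_succ (Submodule.finrank_le _))
    obtain ⟨f⟩ := Function.Embedding.nonempty_of_card_le hcard
    -- Points outside the range of `f` get weight `0` and the arbitrary value `x₀`.
    refine ⟨(Function.extend f w 0, Function.extend f z fun _ => x₀), ⟨⟨fun i => ?_, ?_⟩, ?_⟩, ?_⟩
    · by_cases h : ∃ k, f k = i
      · obtain ⟨k, rfl⟩ := h
        simpa [f.injective.extend_apply] using (hw k).le
      · simp [Function.extend_apply' _ _ _ h]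
    · rw [← hw1]
      refine (Fintype.sum_of_injective f f.injective _ _ (fun i hi => ?_) fun k => ?_).symm
      · exact Function.extend_apply' _ _ _ hi
      · simp [f.injective.extend_apply]
    · intro i _
      by_cases h : ∃ k, f k = i
      · obtain ⟨k, rfl⟩ := h
        simpa [f.injective.extend_apply] using hz ⟨k, rfl⟩
      · simpa [Function.extend_apply' _ _ _ h] using hx₀
    · refine (Fintype.sum_of_injective f f.injective _ _ (fun i hi => ?_) fun k => ?_).symm
      · simp [Function.extend_apply' w _ i hi]
      · simp [f.injective.extend_apply]
  · rintro _ ⟨⟨w, z⟩, ⟨hw, hz⟩, rfl⟩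
    exact (convex_convexHull ℝ s).sum_mem (fun i _ => hw.1 i) hw.2
      fun i _ => subset_convexHull ℝ s (hz i trivial)

noncomputable section

/-! ### Measurements and the trace distance -/

/-- The quadratic form `⟨ψ, X ψ⟩`. It is the probability of the outcome `|ψ⟩⟨ψ|` in the state `X`.
Its real part is taken; for positive semidefinite `X` nothing is lost (`coe_quad`). -/
def quad {ι : Type} [Fintype ι] (X : Matrix ι ι ℂ) (ψ : ι → ℂ) : ℝ :=
  (star ψ ⬝ᵥ X *ᵥ ψ).re

section
variable {ι κ : Type} [Fintype ι] [Fintype κ]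

theorem quad_nonneg {X : Matrix ι ι ℂ} (hX : X.PosSemidef) (ψ : ι → ℂ) : 0 ≤ quad X ψ :=
  (Complex.nonneg_iff.1 (hX.dotProduct_mulVec_nonneg ψ)).1

theorem coe_quad {X : Matrix ι ι ℂ} (hX : X.PosSemidef) (ψ : ι → ℂ) :
    (quad X ψ : ℂ) = star ψ ⬝ᵥ X *ᵥ ψ := 
  Complex.ext rfl (by simpa using (Complex.nonneg_iff.1 (hX.dotProduct_mulVec_nonneg ψ)).2)

theorem quad_sub (X Y : Matrix ι ι ℂ) (ψ : ι → ℂ) : quad (X - Y) ψ = quad X ψ - quad Y ψ := by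
  simp [quad, Matrix.sub_mulVec]

theorem quad_sum {Ω : Type} [Fintype Ω] (X : Ω → Matrix ι ι ℂ) (ψ : ι → ℂ) :
    quad (∑ x, X x) ψ = ∑ x, quad (X x) ψ := by
  simp [quad, Matrix.sum_mulVec, dotProduct_sum]

theorem quad_smul (r : ℝ) (X : Matrix ι ι ℂ) (ψ : ι → ℂ) : quad (r • X) ψ = r * quad X ψ := by
  simp [quad, Matrix.smul_mulVec]

theorem quad_mono {X Y : Matrix ι ι ℂ} (h : X ≤ Y) (ψ : ι → ℂ) : quad X ψ ≤ quad Y ψ := by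
  have := quad_nonneg (Matrix.le_iff.1 h) ψ
  rw [quad_sub] at this
  linarith

theorem continuous_quad (ψ : ι → ℂ) : Continuous fun X : Matrix ι ι ℂ => quad X ψ := by
  unfold quad
  fun_prop

theorem quad_conj (V : Matrix ι κ ℂ) (X : Matrix ι ι ℂ) (ψ : κ → ℂ) :
    quad (Vᴴ * X * V) ψ = quad X (V *ᵥ ψ) := by
  simp only [quad, Matrix.star_mulVec, Matrix.dotProduct_mulVec, Matrix.vecMul_vecMul,
    Matrix.mul_assoc]

theorem sum_quad_eq_trace {Ω : Type} [Fintype Ω] [DecidableEq ι] {ψ : Ω → ι → ℂ}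
    (hψ : ∑ x, Matrix.vecMulVec (ψ x) (star (ψ x)) = 1) (X : Matrix ι ι ℂ) :
    ∑ x, quad X (ψ x) = X.trace.re := by
  have : X.trace = ∑ x, star (ψ x) ⬝ᵥ X *ᵥ ψ x := by
    conv_lhs => rw [← Matrix.mul_one X, ← hψ, Finset.mul_sum, Matrix.trace_sum]
    simp [Matrix.mul_vecMulVec, Matrix.trace_vecMulVec, dotProduct_comm]
  simp [this, quad]

/-- A measurement does not increase the trace distance: the total variation distance of the outcome
distributions is a lower bound, because `±(ρ - σ) ≤ |ρ - σ|`. -/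
theorem sum_abs_quad_le_traceDist {Ω : Type} [Fintype Ω] [DecidableEq ι] {ψ : Ω → ι → ℂ}
    (hψ : ∑ x, Matrix.vecMulVec (ψ x) (star (ψ x)) = 1) {ρ σ : Matrix ι ι ℂ}
    (hρ : ρ.IsHermitian) (hσ : σ.IsHermitian) :
    (1 / 2) * ∑ x, |quad ρ (ψ x) - quad σ (ψ x)| ≤ traceDist ρ σ := by
  have hD : IsSelfAdjoint (ρ - σ) := (hρ.sub hσ)
  have e : traceDist ρ σ = (1 / 2) * (Matrix.trace (CFC.abs (ρ - σ))).re := by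
    unfold traceDist CFC.abs
    congr!
  rw [e, ← sum_quad_eq_trace hψ]
  gcongr with x
  have h1 : ρ - σ ≤ CFC.abs (ρ - σ) := by
    rw [← sub_nonneg, CFC.abs_sub_self _ hD]
    exact nsmul_nonneg (CFC.negPart_nonneg _) 2
  have h2 : -(ρ - σ) ≤ CFC.abs (ρ - σ) := by
    rw [← sub_nonneg, sub_neg_eq_add, CFC.abs_add_self _ hD]
    exact nsmul_nonneg (CFC.posPart_nonneg _) 2
  rw [← quad_sub, abs_le']
  refine ⟨quad_mono h1 _, ?_⟩
  rw [neg_sub] at h2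
  have := quad_mono h2 (ψ x)
  rw [quad_sub] at this ⊢
  linarith

/-- The trace distance is bounded below through the Bhattacharyya coefficient of the outcome
distributions of a measurement. -/
theorem one_sub_sum_sqrt_le_traceDist {Ω : Type} [Fintype Ω] [DecidableEq ι] {ψ : Ω → ι → ℂ}
    (hψ : ∑ x, Matrix.vecMulVec (ψ x) (star (ψ x)) = 1) {ρ σ : Matrix ι ι ℂ}
    (hρ : IsState ρ) (hσ : IsState σ) :
    1 - ∑ x, √(quad ρ (ψ x) * quad σ (ψ x)) ≤ traceDist ρ σ := by
  refine le_trans ?_ (sum_abs_quad_le_traceDist hψ hρ.1.isHermitian hσ.1.isHermitian)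
  have h1 := sum_quad_eq_trace hψ ρ
  have h2 := sum_quad_eq_trace hψ σ
  rw [hρ.2, Complex.one_re] at h1
  rw [hσ.2, Complex.one_re] at h2
  have key : ∀ x, (quad ρ (ψ x) + quad σ (ψ x)) / 2 - √(quad ρ (ψ x) * quad σ (ψ x)) ≤
      1 / 2 * |quad ρ (ψ x) - quad σ (ψ x)| := by
    intro x
    have hp := quad_nonneg hρ.1 (ψ x)
    have hq := quad_nonneg hσ.1 (ψ x)
    generalize quad ρ (ψ x) = p at *
    generalize quad σ (ψ x) = q at *
    -- `(p + q) / 2 = |p - q| / 2 + min p q`, and `min p q ≤ √(p * q)`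
    have hm : min p q ≤ √(p * q) := by
      apply Real.le_sqrt_of_sq_le
      rw [sq]
      exact mul_le_mul (min_le_left _ _) (min_le_right _ _) (le_min hp hq) hp
    have := min_add_max p q
    have := max_sub_min_eq_abs p q
    rw [abs_sub_comm] at this
    linarith
  calc _ = ∑ x, ((quad ρ (ψ x) + quad σ (ψ x)) / 2 - √(quad ρ (ψ x) * quad σ (ψ x))) := by
        rw [Finset.sum_sub_distrib, ← Finset.sum_div, Finset.sum_add_distrib, h1, h2]
        norm_num
    _ ≤ _ := by
        rw [Finset.mul_sum]
        exact Finset.sum_le_sum fun x _ => key x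

end

/-! ### Product vectors and separable states -/

section
variable {A B A' B' : Type}

theorem kronecker_mulVec_tensorVec [Fintype A] [Fintype B] (K : Matrix A' A ℂ)
    (L : Matrix B' B ℂ) (a : A → ℂ) (b : B → ℂ) :
    (K ⊗ₖ L) *ᵥ tensorVec a b = tensorVec (K *ᵥ a) (L *ᵥ b) := by
  ext p
  simp only [Matrix.mulVec, dotProduct, tensorVec, Fintype.sum_prod_type, Finset.sum_mul_sum,
    Matrix.kroneckerMap_apply]
  exact Finset.sum_congr rfl fun _ _ => Finset.sum_congr rfl fun _ _ => by ring

theorem star_tensorVec (a : A → ℂ) (b : B → ℂ) :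
    star (tensorVec a b) = tensorVec (star a) (star b) := by
  ext p
  simp [tensorVec]

theorem tensorVec_tensorVec_comp (a : A → ℂ) (b : B → ℂ) (a' : A' → ℂ) (b' : B' → ℂ) :
    tensorVec (tensorVec a a') (tensorVec b b') ∘ Equiv.prodProdProdComm A B A' B' =
      tensorVec (tensorVec a b) (tensorVec a' b') := by
  ext p
  simp only [tensorVec, Function.comp, Equiv.prodProdProdComm_apply]
  ring

theorem vecMulVec_smul_tensorVec (r : ℝ) (a : A → ℂ) (b : B → ℂ) :
    Matrix.vecMulVec (tensorVec ((r : ℂ) • a) b) (star (tensorVec ((r : ℂ) • a) b)) =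
      (r ^ 2) • Matrix.vecMulVec (tensorVec a b) (star (tensorVec a b)) := by
  ext p q
  simp [Matrix.vecMulVec_apply, tensorVec]
  ring

variable (A B) in
/-- The cone of unnormalized separable states: finite sums of `|ψ⟩⟨ψ|` with `ψ` a product vector of
arbitrary norm. It is convenient because it is stable under local operations which do not preserve
the trace. -/
def sepCone : AddSubmonoid (Matrix (A × B) (A × B) ℂ) :=
  AddSubmonoid.closure
    {M | ∃ (a : A → ℂ) (b : B → ℂ), M = Matrix.vecMulVec (tensorVec a b) (star (tensorVec a b))}

theorem smul_mem_sepCone {r : ℝ} (hr : 0 ≤ r) {X : Matrix (A × B) (A × B) ℂ}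
    (hX : X ∈ sepCone A B) : r • X ∈ sepCone A B := by
  induction hX using AddSubmonoid.closure_induction with
  | mem X h =>
    obtain ⟨a, b, rfl⟩ := h
    refine AddSubmonoid.subset_closure ⟨((√r : ℝ) : ℂ) • a, b, ?_⟩
    rw [vecMulVec_smul_tensorVec, Real.sq_sqrt hr]
  | zero => simp
  | add X Y _ _ hX hY => simpa using add_mem hX hY

/-- A local operation `X ↦ (K ⊗ L)ᴴ X (K ⊗ L)` keeps states separable. -/
theorem conj_kronecker_mem_sepCone [Fintype A'] [Fintype B'] (K : Matrix A' A ℂ)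
    (L : Matrix B' B ℂ) {X : Matrix (A' × B') (A' × B') ℂ} (hX : X ∈ sepCone A' B') :
    (K ⊗ₖ L)ᴴ * X * (K ⊗ₖ L) ∈ sepCone A B := by
  induction hX using AddSubmonoid.closure_induction with
  | mem X h =>
    obtain ⟨a, b, rfl⟩ := h
    refine AddSubmonoid.subset_closure ⟨Kᴴ *ᵥ a, Lᴴ *ᵥ b, ?_⟩
    rw [← kronecker_mulVec_tensorVec, ← Matrix.conjTranspose_kronecker, Matrix.mul_vecMulVec,
      Matrix.vecMulVec_mul, Matrix.star_mulVec, Matrix.conjTranspose_conjTranspose]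
  | zero => simp
  | add X Y _ _ hX hY =>
    rw [Matrix.mul_add, Matrix.add_mul]
    exact add_mem hX hY

variable [Fintype A] [Fintype B] [Fintype A'] [Fintype B']

theorem tensorVec_dotProduct_tensorVec (a c : A → ℂ) (b d : B → ℂ) :
    tensorVec a b ⬝ᵥ tensorVec c d = (a ⬝ᵥ c) * (b ⬝ᵥ d) := by
  simp only [dotProduct, tensorVec, Fintype.sum_prod_type, Finset.sum_mul_sum]
  exact Finset.sum_congr rfl fun _ _ => Finset.sum_congr rfl fun _ _ => by ring

theorem quad_bipartiteTensor {ρ : Matrix (A × B) (A × B) ℂ} {σ : Matrix (A' × B') (A' × B') ℂ}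
    (hρ : ρ.PosSemidef) (hσ : σ.PosSemidef) (a : A → ℂ) (b : B → ℂ) (a' : A' → ℂ) (b' : B' → ℂ) :
    quad (bipartiteTensor ρ σ) (tensorVec (tensorVec a a') (tensorVec b b')) =
      quad ρ (tensorVec a b) * quad σ (tensorVec a' b') := by
  have h : star (tensorVec (tensorVec a a') (tensorVec b b')) ⬝ᵥ
      bipartiteTensor ρ σ *ᵥ tensorVec (tensorVec a a') (tensorVec b b') =
      (star (tensorVec a b) ⬝ᵥ ρ *ᵥ tensorVec a b) *
        (star (tensorVec a' b') ⬝ᵥ σ *ᵥ tensorVec a' b') := by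
    rw [bipartiteTensor, Matrix.reindex_apply, Matrix.submatrix_mulVec_equiv, Equiv.symm_symm,
      tensorVec_tensorVec_comp, kronecker_mulVec_tensorVec, dotProduct_comp_equiv_symm]
    simp only [star_tensorVec, tensorVec_tensorVec_comp, tensorVec_dotProduct_tensorVec]
  rw [quad, h, ← coe_quad hρ, ← coe_quad hσ, ← Complex.ofReal_mul, Complex.ofReal_re]

theorem IsState.bipartiteTensor {ρ : Matrix (A × B) (A × B) ℂ}
    {σ : Matrix (A' × B') (A' × B') ℂ} (hρ : IsState ρ) (hσ : IsState σ) :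
    IsState (bipartiteTensor ρ σ) := by
  refine ⟨(hρ.1.kronecker hσ.1).submatrix _, ?_⟩
  have : (_root_.bipartiteTensor ρ σ).trace = (ρ ⊗ₖ σ).trace :=
    Equiv.sum_comp (Equiv.prodProdProdComm A B A' B').symm fun p => (ρ ⊗ₖ σ) p p
  rw [this, Matrix.trace_kronecker, hρ.2, hσ.2, one_mul]

theorem posSemidef_of_mem_sepCone {X : Matrix (A × B) (A × B) ℂ} (hX : X ∈ sepCone A B) :
    X.PosSemidef := by
  induction hX using AddSubmonoid.closure_induction with
  | mem X h =>
    obtain ⟨a, b, rfl⟩ := h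
    exact Matrix.posSemidef_vecMulVec_self_star _
  | zero => exact Matrix.PosSemidef.zero
  | add X Y _ _ hX hY => exact hX.add hY

theorem SEP_subset_sepCone : SEP A B ⊆ sepCone A B := by
  refine convexHull_min ?_ ?_
  · rintro _ ⟨_, _, ⟨a, b, rfl⟩, rfl⟩
    exact AddSubmonoid.subset_closure ⟨a, b, rfl⟩
  · intro X hX Y hY s t hs ht _
    exact add_mem (smul_mem_sepCone hs hX) (smul_mem_sepCone ht hY)

theorem trace_of_mem_SEP {X : Matrix (A × B) (A × B) ℂ} (hX : X ∈ SEP A B) : X.trace = 1 := by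
  have h : SEP A B ⊆ {X | X.trace = 1} := by
    refine convexHull_min ?_ ?_
    · rintro _ ⟨ψ, hψ, -, rfl⟩
      rw [Set.mem_ofPred_eq, Matrix.trace_vecMulVec, dotProduct_comm, hψ]
    · intro X hX Y hY s t hs ht hst
      rw [Set.mem_ofPred_eq] at *
      rw [Matrix.trace_add, Matrix.trace_smul, Matrix.trace_smul, hX, hY, ← add_smul, hst, one_smul]
  exact h hX

theorem isState_of_mem_SEP {X : Matrix (A × B) (A × B) ℂ} (hX : X ∈ SEP A B) : IsState X :=
  ⟨posSemidef_of_mem_sepCone (SEP_subset_sepCone hX), trace_of_mem_SEP hX⟩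

theorem exists_smul_SEP_of_mem_sepCone {X : Matrix (A × B) (A × B) ℂ} (hX : X ∈ sepCone A B) :
    X = 0 ∨ ∃ r : ℝ, 0 < r ∧ ∃ Y ∈ SEP A B, X = r • Y := by
  induction hX using AddSubmonoid.closure_induction with
  | mem X h =>
    obtain ⟨a, b, rfl⟩ := h
    rcases eq_or_ne (tensorVec a b) 0 with h0 | h0
    · simp [h0]
    · have hpos := Matrix.dotProduct_star_self_pos_iff.2 h0
      obtain ⟨hr, him⟩ := Complex.pos_iff.1 hpos
      set c := star (tensorVec a b) ⬝ᵥ tensorVec a b with hc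
      have hcr : c = ((c.re : ℝ) : ℂ) := Complex.ext rfl (by simpa using him.symm)
      have hs : (√c.re)⁻¹ ^ 2 * c.re = 1 := by
        rw [inv_pow, Real.sq_sqrt hr.le, inv_mul_cancel₀ hr.ne']
      refine Or.inr ⟨c.re, hr, _, subset_convexHull ℝ _
        ⟨tensorVec ((((√c.re)⁻¹ : ℝ) : ℂ) • a) b, ?_, ⟨_, _, rfl⟩, rfl⟩, ?_⟩
      · rw [dotProduct_comm, ← Matrix.trace_vecMulVec, vecMulVec_smul_tensorVec, Matrix.trace_smul,
          Matrix.trace_vecMulVec, dotProduct_comm, ← hc, hcr, Complex.real_smul, Complex.ofReal_re,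
          ← Complex.ofReal_mul, hs, Complex.ofReal_one]
      · rw [vecMulVec_smul_tensorVec, smul_smul, mul_comm, hs, one_smul]
  | zero => exact Or.inl rfl
  | add X Y _ _ hX hY =>
    rcases hX with rfl | ⟨r, hr, X, hX, rfl⟩
    · simpa using hY
    rcases hY with rfl | ⟨s, hs, Y, hY, rfl⟩
    · exact Or.inr ⟨r, hr, X, hX, by simp⟩
    have hrs : 0 < r + s := by positivity
    refine Or.inr ⟨r + s, hrs, (r / (r + s)) • X + (s / (r + s)) • Y,
      convex_convexHull ℝ _ hX hY (by positivity) (by positivity) (by field_simp), ?_⟩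
    rw [smul_add, smul_smul, smul_smul, mul_div_cancel₀ _ hrs.ne', mul_div_cancel₀ _ hrs.ne']

theorem isCompact_SEP : IsCompact (SEP A B) := by
  have hcont : Continuous fun q : (A → ℂ) × (B → ℂ) =>
      Matrix.vecMulVec (tensorVec q.1 q.2) (star (tensorVec q.1 q.2)) := by
    refine continuous_matrix fun p q => ?_
    simp only [Matrix.vecMulVec_apply, tensorVec, Pi.star_apply]
    fun_prop
  have hball {ι : Type} [Fintype ι] : IsCompact {v : ι → ℂ | star v ⬝ᵥ v = 1} := by
    refine Metric.isCompact_of_isClosed_isBounded ?_ ?_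
    · exact isClosed_eq (by simp only [dotProduct, Pi.star_apply]; fun_prop) continuous_const
    · refine (Metric.isBounded_closedBall (x := (0 : ι → ℂ)) (r := 1)).subset fun v hv => ?_
      rw [mem_closedBall_zero_iff, pi_norm_le_iff_of_nonneg zero_le_one]
      intro i
      have h1 : ∑ j, ‖v j‖ ^ 2 = 1 := by
        have h2 : ((∑ j, ‖v j‖ ^ 2 : ℝ) : ℂ) = star v ⬝ᵥ v := by
          simp [dotProduct, Complex.conj_mul']
        rw [show star v ⬝ᵥ v = 1 from hv] at h2
        exact_mod_cast h2
      have h3 := Finset.single_le_sum (f := fun j => ‖v j‖ ^ 2) (fun j _ => sq_nonneg _)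
        (Finset.mem_univ i)
      rw [h1] at h3
      exact (sq_le_one_iff₀ (norm_nonneg _)).1 h3
  refine IsCompact.convexHull_of_finiteDimensional ?_
  convert (hball.prod hball).image hcont using 1
  refine Set.Subset.antisymm ?_ ?_
  · rintro _ ⟨_, h1, ⟨a, b, rfl⟩, rfl⟩
    have hab : (star a ⬝ᵥ a) * (star b ⬝ᵥ b) = 1 := by
      rw [← tensorVec_dotProduct_tensorVec, ← star_tensorVec, h1]
    -- Rescale so that both factors are unit vectors.
    have ha0 : 0 ≤ star a ⬝ᵥ a := dotProduct_star_self_nonneg a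
    obtain ⟨hr, him⟩ := Complex.nonneg_iff.1 ha0
    set c := star a ⬝ᵥ a with hc
    have hcr : c = ((c.re : ℝ) : ℂ) := Complex.ext rfl (by simpa using him.symm)
    have hc0 : 0 < c.re := hr.lt_of_ne' fun h => by
      rw [hcr, h] at hab
      simp at hab
    have hsne : (√c.re : ℂ) ≠ 0 := by exact_mod_cast (Real.sqrt_pos.2 hc0).ne'
    have hsq : (√c.re : ℂ) * √c.re = c := by
      rw [← Complex.ofReal_mul, Real.mul_self_sqrt hr, ← hcr]
    refine ⟨((√c.re : ℂ)⁻¹ • a, (√c.re : ℂ) • b), ⟨?_, ?_⟩, ?_⟩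
    · simp only [Set.mem_ofPred_eq, star_smul, smul_dotProduct, dotProduct_smul, smul_eq_mul, ← hc]
      rw [← hsq]
      simp
      field_simp
    · simp only [Set.mem_ofPred_eq, star_smul, smul_dotProduct, dotProduct_smul, smul_eq_mul]
      simp only [Complex.star_def, Complex.conj_ofReal]
      rw [← mul_assoc, hsq, hab]
    · have : tensorVec ((√c.re : ℂ)⁻¹ • a) ((√c.re : ℂ) • b) = tensorVec a b := by
        ext p
        simp only [tensorVec, Pi.smul_apply, smul_eq_mul]
        field_simp
      simp only [this]
  · rintro _ ⟨⟨a, b⟩, ⟨ha, hb⟩, rfl⟩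
    refine ⟨_, ?_, ⟨a, b, rfl⟩, rfl⟩
    rw [star_tensorVec, tensorVec_dotProduct_tensorVec, show star a ⬝ᵥ a = 1 from ha,
      show star b ⬝ᵥ b = 1 from hb, one_mul]

end

/-! ### Product measurements on tensor products -/

section
variable {A B A' B' : Type} [Fintype A] [Fintype B] [Fintype A'] [Fintype B']

open Classical in
/-- A measurement with finitely many outcomes whose elements are the rank-one operators `|ψ⟩⟨ψ|`
given by the (not normalized) product vectors `ψ = left x ⊗ right x`. -/
structure ProductMeasurement (A B : Type) [Fintype A] [Fintype B] where
  Outcome : Type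
  [fintypeOutcome : Fintype Outcome]
  left : Outcome → A → ℂ
  right : Outcome → B → ℂ
  sum_vecMulVec : ∑ x, Matrix.vecMulVec (tensorVec (left x) (right x))
    (star (tensorVec (left x) (right x))) = 1

attribute [instance] ProductMeasurement.fintypeOutcome

namespace ProductMeasurement

/-- The product vector belonging to an outcome. -/
def vec (M : ProductMeasurement A B) (x : M.Outcome) : A × B → ℂ :=
  tensorVec (M.left x) (M.right x)

theorem sum_quad (M : ProductMeasurement A B) (X : Matrix (A × B) (A × B) ℂ) :
    ∑ x, quad X (M.vec x) = X.trace.re := by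
  classical
  refine sum_quad_eq_trace ?_ X
  unfold vec
  convert M.sum_vecMulVec

/-- The measurement on `(A ⊗ A') ⊗ (B ⊗ B')` which applies `M` to `A ⊗ B` and `M'` to
`A' ⊗ B'`. -/
def prod (M : ProductMeasurement A B) (M' : ProductMeasurement A' B') :
    ProductMeasurement (A × A') (B × B') where
  Outcome := M.Outcome × M'.Outcome
  left x := tensorVec (M.left x.1) (M'.left x.2)
  right x := tensorVec (M.right x.1) (M'.right x.2)
  sum_vecMulVec := by
    classical
    ext ⟨⟨a, a'⟩, b, b'⟩ ⟨⟨c, c'⟩, d, d'⟩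
    have h := congr_fun₂ M.sum_vecMulVec (a, b) (c, d)
    have h' := congr_fun₂ M'.sum_vecMulVec (a', b') (c', d')
    simp only [Matrix.sum_apply, Matrix.vecMulVec_apply, tensorVec, Pi.star_apply, star_mul',
      Matrix.one_apply, Prod.mk.injEq] at h h' ⊢
    calc _ = (if a = c ∧ b = d then (1 : ℂ) else 0) * if a' = c' ∧ b' = d' then 1 else 0 := by
          rw [← h, ← h', Fintype.sum_prod_type, Finset.sum_mul_sum]
          exact Finset.sum_congr rfl fun _ _ => Finset.sum_congr rfl fun _ _ => by ring
      _ = _ := by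
          rw [ite_zero_mul_ite_zero, mul_one]
          exact if_congr (by tauto) rfl rfl

theorem sum_prod_outcome (M : ProductMeasurement A B) (M' : ProductMeasurement A' B')
    (f : (M.prod M').Outcome → ℝ) : ∑ x, f x = ∑ x : M.Outcome, ∑ x' : M'.Outcome, f (x, x') :=
  Fintype.sum_prod_type (γ := ℝ) (α₁ := M.Outcome) (α₂ := M'.Outcome) f

/-- The Bhattacharyya coefficient of the outcome distributions of two states. -/
def overlap (M : ProductMeasurement A B) (ρ σ : Matrix (A × B) (A × B) ℂ) : ℝ :=
  ∑ x, √(quad ρ (M.vec x) * quad σ (M.vec x))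

theorem overlap_nonneg (M : ProductMeasurement A B) (ρ σ : Matrix (A × B) (A × B) ℂ) :
    0 ≤ M.overlap ρ σ :=
  Finset.sum_nonneg fun _ _ => Real.sqrt_nonneg _

theorem overlap_smul_right (M : ProductMeasurement A B) (ρ σ : Matrix (A × B) (A × B) ℂ)
    {r : ℝ} (hr : 0 ≤ r) : M.overlap ρ (r • σ) = √r * M.overlap ρ σ := by
  simp only [overlap, Finset.mul_sum, quad_smul]
  refine Finset.sum_congr rfl fun x _ => ?_
  rw [← Real.sqrt_mul hr]
  congr 1
  ring

theorem one_sub_overlap_le_traceDist (M : ProductMeasurement A B) {ρ σ : Matrix (A × B) (A × B) ℂ}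
    (hρ : IsState ρ) (hσ : IsState σ) : 1 - M.overlap ρ σ ≤ traceDist ρ σ := by
  classical
  refine one_sub_sum_sqrt_le_traceDist ?_ hρ hσ
  unfold vec
  convert M.sum_vecMulVec

/-- The overlap of `ρ` with every separable state is at most `β`, in the homogeneous form that
applies to unnormalized separable states. -/
def Distinguishes (M : ProductMeasurement A B) (ρ : Matrix (A × B) (A × B) ℂ) (β : ℝ) : Prop :=
  ∀ σ ∈ sepCone A B, M.overlap ρ σ ≤ β * √σ.trace.re

theorem distinguishes_of_SEP {M : ProductMeasurement A B} {ρ : Matrix (A × B) (A × B) ℂ} {β : ℝ}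
    (h : ∀ σ ∈ SEP A B, M.overlap ρ σ ≤ β) : M.Distinguishes ρ β := by
  intro σ hσ
  obtain rfl | ⟨r, hr, Y, hY, rfl⟩ := exists_smul_SEP_of_mem_sepCone hσ
  · simp [overlap, quad]
  · rw [M.overlap_smul_right _ _ hr.le, Matrix.trace_smul, trace_of_mem_SEP hY, mul_comm β]
    simpa using mul_le_mul_of_nonneg_left (h Y hY) (Real.sqrt_nonneg r)

open Classical in
/-- Projecting the second subsystems `A'` and `B'` of a separable state onto vectors `a'` and `b'`
leaves an (unnormalized) separable state of `A ⊗ B`. -/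
theorem exists_slice_left {σ : Matrix ((A × A') × (B × B')) ((A × A') × (B × B')) ℂ}
    (hσ : σ ∈ sepCone (A × A') (B × B')) (a' : A' → ℂ) (b' : B' → ℂ) :
    ∃ τ ∈ sepCone A B, ∀ a b, quad τ (tensorVec a b) =
      quad σ (tensorVec (tensorVec a a') (tensorVec b b')) := by
  -- The matrix of `c ↦ c ⊗ c'`; conjugating with it projects the second factor onto `c'`.
  have key {C C' : Type} [Fintype C] (c : C → ℂ) (c' : C' → ℂ) :
      (Matrix.of fun (p : C × C') i => if p.1 = i then c' p.2 else 0) *ᵥ c = tensorVec c c' := by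
    ext p
    simp [Matrix.mulVec, dotProduct, tensorVec, mul_comm]
  exact ⟨_, conj_kronecker_mem_sepCone _ _ hσ, fun a b => by
    rw [quad_conj, kronecker_mulVec_tensorVec, key _ a', key _ b']⟩

open Classical in
/-- Projecting the first subsystems `A` and `B` of a separable state onto vectors `a` and `b` leaves
an (unnormalized) separable state of `A' ⊗ B'`. -/
theorem exists_slice_right {σ : Matrix ((A × A') × (B × B')) ((A × A') × (B × B')) ℂ}
    (hσ : σ ∈ sepCone (A × A') (B × B')) (a : A → ℂ) (b : B → ℂ) :
    ∃ τ ∈ sepCone A' B', ∀ a' b', quad τ (tensorVec a' b') =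
      quad σ (tensorVec (tensorVec a a') (tensorVec b b')) := by
  have key {C C' : Type} [Fintype C'] (c : C → ℂ) (c' : C' → ℂ) :
      (Matrix.of fun (p : C × C') i => if p.2 = i then c p.1 else 0) *ᵥ c' = tensorVec c c' := by
    ext p
    simp [Matrix.mulVec, dotProduct, tensorVec]
  exact ⟨_, conj_kronecker_mem_sepCone _ _ hσ, fun a' b' => by
    rw [quad_conj, kronecker_mulVec_tensorVec, key a, key b]⟩

/-- The bounds multiply. For each outcome `x'` of `M'`, the state of `A ⊗ B` conditional on `x'` is
separable and so contributes a factor `β`; its trace is the probability of `x'` in the marginal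
state on `A' ⊗ B'`, which is separable as well and gives the factor `γ`. -/
theorem Distinguishes.prod {M : ProductMeasurement A B} {M' : ProductMeasurement A' B'}
    {ρ : Matrix (A × B) (A × B) ℂ} {ρ' : Matrix (A' × B') (A' × B') ℂ} {β γ : ℝ}
    (hβ : 0 ≤ β) (hρ : IsState ρ) (hρ' : IsState ρ')
    (h : M.Distinguishes ρ β) (h' : M'.Distinguishes ρ' γ) :
    (M.prod M').Distinguishes (bipartiteTensor ρ ρ') (β * γ) := by
  intro σ hσ
  choose L hL hLq using fun x' => exists_slice_left hσ (M'.left x') (M'.right x')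
  choose R hR hRq using fun x => exists_slice_right hσ (M.left x) (M.right x)
  -- `∑ x, R x` is the marginal of `σ` on `A' ⊗ B'`, computed by measuring `A ⊗ B`.
  have hRcone : ∑ x, R x ∈ sepCone A' B' := sum_mem fun x _ => hR x
  have htr (x') : (L x').trace.re = quad (∑ x, R x) (M'.vec x') := by
    rw [← M.sum_quad, quad_sum]
    exact Finset.sum_congr rfl fun x _ => (hLq x' _ _).trans (hRq x _ _).symm
  have htr' : (∑ x, R x).trace.re = σ.trace.re := by
    rw [← M'.sum_quad, ← (M.prod M').sum_quad]
    simp only [quad_sum]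
    rw [Finset.sum_comm, sum_prod_outcome]
    exact Finset.sum_congr rfl fun x _ => Finset.sum_congr rfl fun x' _ => hRq x _ _
  calc (M.prod M').overlap (bipartiteTensor ρ ρ') σ
      = ∑ x', √(quad ρ' (M'.vec x')) * M.overlap ρ (L x') := by
        simp only [overlap, Finset.mul_sum]
        rw [sum_prod_outcome, Finset.sum_comm]
        refine Finset.sum_congr rfl fun x' _ => Finset.sum_congr rfl fun x _ => ?_
        rw [← Real.sqrt_mul (quad_nonneg hρ'.1 _)]
        congr 1
        simp only [vec, ProductMeasurement.prod, hLq, quad_bipartiteTensor hρ.1 hρ'.1]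
        ring
    _ ≤ ∑ x', √(quad ρ' (M'.vec x')) * (β * √(L x').trace.re) := by
        gcongr with x'
        exact h _ (hL x')
    _ = β * M'.overlap ρ' (∑ x, R x) := by
        simp only [overlap, Finset.mul_sum, htr]
        refine Finset.sum_congr rfl fun x' _ => ?_
        rw [Real.sqrt_mul (quad_nonneg hρ'.1 _)]
        ring
    _ ≤ β * (γ * √(∑ x, R x).trace.re) := by
        gcongr
        exact h' _ hRcone
    _ = β * γ * √σ.trace.re := by rw [htr', mul_assoc]

end ProductMeasurement

end

/-! ### An informationally complete product measurement -/

section polarization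

variable {A B : Type} [Fintype A] [Fintype B]

open Complex

open Classical in
/-- The vectors `e_k + i ^ m e_l`, scaled such that their projectors sum to the identity. By
polarization, a matrix is determined by its quadratic form on them. -/
def polarVec (x : (A × A) × Fin 4) : A → ℂ :=
  (((√(8 * Fintype.card A))⁻¹ : ℝ) : ℂ) • (Pi.single x.1.1 1 + I ^ (x.2 : ℕ) • Pi.single x.1.2 1)

open Classical in
theorem sum_polarVec (i j : A) :
    ∑ x, polarVec x i * star (polarVec x j) = if i = j then (1 : ℂ) else 0 := by
  have hd : 0 < Fintype.card A := Fintype.card_pos_iff.2 ⟨i⟩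
  have hd' : (Fintype.card A : ℂ) ≠ 0 := by exact_mod_cast hd.ne'
  set c : ℂ := (((√(8 * Fintype.card A))⁻¹ : ℝ) : ℂ) with hc
  have hcc : c * c * (8 * Fintype.card A) = 1 := by
    rw [hc, ← ofReal_mul, ← mul_inv, Real.mul_self_sqrt (by positivity)]
    push_cast
    field_simp
  -- The terms with a factor `I ^ m` cancel in the sum over `m`.
  have h4 (k l : A) : ∑ m, polarVec ((k, l), m) i * star (polarVec ((k, l), m) j) =
      c * c * 4 * ((if i = k then if j = k then 1 else 0 else 0) +
        if i = l then if j = l then 1 else 0 else 0) := by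
    simp only [polarVec, ← hc, Pi.smul_apply, Pi.add_apply, Pi.single_apply, smul_eq_mul, star_mul',
      star_add, Fin.sum_univ_four]
    have hcs : star c = c := by simp [hc]
    have hI : I ^ 3 = -I := by rw [pow_succ, I_sq]; ring
    rw [hcs]
    split_ifs <;> simp [hI] <;> ring_nf <;> simp <;> ring
  rw [Fintype.sum_prod_type, Fintype.sum_prod_type]
  simp only [h4, ← Finset.mul_sum, Finset.sum_add_distrib, Finset.sum_const, Finset.card_univ,
    Finset.sum_ite_eq, Finset.mem_univ, if_true, eq_comm (a := j)]
  simp only [Finset.sum_ite_eq, Finset.mem_univ, if_true, nsmul_eq_mul, ← Finset.mul_sum]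
  split_ifs
  · linear_combination hcc
  · simp

theorem eq_zero_of_polarVec {X : Matrix A A ℂ}
    (h : ∀ x, star (polarVec x) ⬝ᵥ X *ᵥ polarVec x = 0) : X = 0 := by
  classical
  ext k l
  have hd : 0 < Fintype.card A := Fintype.card_pos_iff.2 ⟨k⟩
  have hc : (((√(8 * Fintype.card A))⁻¹ : ℝ) : ℂ) ≠ 0 := by
    rw [ofReal_ne_zero]
    positivity
  have hcs : star (((√(8 * Fintype.card A))⁻¹ : ℝ) : ℂ) = ((√(8 * Fintype.card A))⁻¹ : ℝ) :=
    conj_ofReal _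
  have hm (m : Fin 4) : X k k + I ^ (m : ℕ) * X k l + star (I ^ (m : ℕ)) * X l k + X l l = 0 := by
    have := h ((k, l), m)
    have e : star (I ^ (m : ℕ)) * I ^ (m : ℕ) = 1 := by
      rw [star_pow, ← mul_pow]
      simp
    simp only [polarVec, star_smul, smul_dotProduct, Matrix.mulVec_smul, dotProduct_smul,
      smul_eq_mul, star_add, ← Pi.single_star, star_one,
      Matrix.mulVec_add, add_dotProduct, dotProduct_add, single_one_dotProduct,
      Matrix.mulVec_single_one, Matrix.col_apply] at this
    rw [hcs] at this
    refine mul_left_cancel₀ (mul_ne_zero hc hc) ?_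
    linear_combination this - (((√(8 * Fintype.card A))⁻¹ : ℝ) : ℂ) ^ 2 * X l l * e
  have hI : I ^ 3 = -I := by rw [pow_succ, I_sq]; ring
  have h0 := hm 0
  have h1 := hm 1
  have h2 := hm 2
  have h3 := hm 3
  simp [hI] at h0 h1 h2 h3
  -- The combination of the four identities with weights `conj (I ^ m)` is `4 * X k l = 0`.
  have : 4 * X k l = 0 := by
    linear_combination h0 - I * h1 - h2 + I * h3 + (2 * X k l - 2 * X l k) * I_sq
  simpa using this

theorem eq_zero_of_tensorVec_polarVec {X : Matrix (A × B) (A × B) ℂ}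
    (h : ∀ x y, star (tensorVec (polarVec x) (polarVec y)) ⬝ᵥ
      X *ᵥ tensorVec (polarVec x) (polarVec y) = 0) : X = 0 := by
  -- Polarize over `A` first, with the vector of `B` fixed, and then over `B`.
  let Z (a a' : A) : Matrix B B ℂ := Matrix.of fun b b' => X (a, b) (a', b')
  have h1 (y) : (Matrix.of fun a a' => star (polarVec y) ⬝ᵥ Z a a' *ᵥ polarVec y) =
      (0 : Matrix A A ℂ) := by
    refine eq_zero_of_polarVec fun x => ?_
    rw [← h x y]
    simp only [dotProduct, Matrix.mulVec, Fintype.sum_prod_type, Matrix.of_apply, Pi.star_apply,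
      tensorVec, Finset.mul_sum, Finset.sum_mul, star_mul', Z]
    refine Finset.sum_congr rfl fun a _ => ?_
    rw [Finset.sum_comm]
    refine Finset.sum_congr rfl fun b _ => Finset.sum_congr rfl fun a' _ =>
      Finset.sum_congr rfl fun b' _ => by ring
  ext ⟨a, b⟩ ⟨a', b'⟩
  have h2 : Z a a' = 0 := eq_zero_of_polarVec fun y => congr_fun₂ (h1 y) a a'
  exact congr_fun₂ h2 b b'

variable (A B) in
/-- An informationally complete product measurement: both parties measure in the vectors
`polarVec`. -/
def polarMeasurement : ProductMeasurement A B where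
  Outcome := ((A × A) × Fin 4) × ((B × B) × Fin 4)
  left x := polarVec x.1
  right x := polarVec x.2
  sum_vecMulVec := by
    classical
    ext ⟨a, b⟩ ⟨c, d⟩
    simp only [Matrix.sum_apply, Matrix.vecMulVec_apply, tensorVec, Pi.star_apply, star_mul',
      Matrix.one_apply, Prod.mk.injEq]
    calc _ = (if a = c then (1 : ℂ) else 0) * if b = d then 1 else 0 := by
          rw [← sum_polarVec, ← sum_polarVec, Fintype.sum_prod_type, Finset.sum_mul_sum]
          exact Finset.sum_congr rfl fun _ _ => Finset.sum_congr rfl fun _ _ => by ring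
      _ = _ := by
          rw [ite_zero_mul_ite_zero, mul_one]

/-- Equality would force the outcome distributions to coincide, and these determine the state. -/
theorem polarMeasurement_overlap_lt_one {ρ σ : Matrix (A × B) (A × B) ℂ} (hρ : IsState ρ)
    (hσ : IsState σ) (hne : ρ ≠ σ) : (polarMeasurement A B).overlap ρ σ < 1 := by
  set M := polarMeasurement A B
  by_contra! hle
  have h1 := M.sum_quad ρ
  have h2 := M.sum_quad σ
  rw [hρ.2, one_re] at h1
  rw [hσ.2, one_re] at h2
  -- For probability distributions, `∑ (√p - √q) ^ 2 = 2 - 2 * ∑ √(p * q)`.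
  have hsum : ∑ x, (√(quad ρ (M.vec x)) - √(quad σ (M.vec x))) ^ 2 ≤ 0 := by
    calc _ = ∑ x, (quad ρ (M.vec x) + quad σ (M.vec x)
          - 2 * √(quad ρ (M.vec x) * quad σ (M.vec x))) := by
          refine Finset.sum_congr rfl fun x _ => ?_
          rw [sub_sq, Real.sq_sqrt (quad_nonneg hρ.1 _), Real.sq_sqrt (quad_nonneg hσ.1 _),
            Real.sqrt_mul (quad_nonneg hρ.1 _)]
          ring
      _ = 2 - 2 * M.overlap ρ σ := by
          rw [Finset.sum_sub_distrib, Finset.sum_add_distrib, h1, h2, ← Finset.mul_sum]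
          norm_num [ProductMeasurement.overlap]
      _ ≤ 0 := by linarith
  have hz := (Finset.sum_eq_zero_iff_of_nonneg fun x _ => sq_nonneg _).1
    (hsum.antisymm (Finset.sum_nonneg fun x _ => sq_nonneg _))
  refine hne (sub_eq_zero.1 (eq_zero_of_tensorVec_polarVec fun x y => ?_))
  have hxy : √(quad ρ (M.vec (x, y))) = √(quad σ (M.vec (x, y))) :=
    sub_eq_zero.1 (pow_eq_zero_iff two_ne_zero |>.1 (hz (x, y) (Finset.mem_univ _)))
  rw [Real.sqrt_inj (quad_nonneg hρ.1 _) (quad_nonneg hσ.1 _)] at hxy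
  change star (M.vec (x, y)) ⬝ᵥ (ρ - σ) *ᵥ M.vec (x, y) = 0
  rw [Matrix.sub_mulVec, dotProduct_sub, ← coe_quad hρ.1, ← coe_quad hσ.1, hxy, sub_self]

end polarization

/-! ### Tensor powers of an entangled state -/

/-- The overlap with an entangled state is less than `1` uniformly on the separable states, by
compactness. -/
theorem exists_distinguishes {A B : Type} [Fintype A] [Fintype B]
    {ρ : Matrix (A × B) (A × B) ℂ} (hρ : IsState ρ) (hsep : ρ ∉ SEP A B) :
    ∃ β, 0 ≤ β ∧ β < 1 ∧ (polarMeasurement A B).Distinguishes ρ β := by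
  rcases (SEP A B).eq_empty_or_nonempty with h0 | h0
  · exact ⟨0, le_rfl, one_pos, ProductMeasurement.distinguishes_of_SEP (by simp [h0])⟩
  have hcont : Continuous ((polarMeasurement A B).overlap ρ) :=
    continuous_finsetSum _ fun x _ => (continuous_const.mul (continuous_quad _)).sqrt
  obtain ⟨σ, hσ, hmax⟩ := isCompact_SEP.exists_isMaxOn h0 hcont.continuousOn
  exact ⟨_, ProductMeasurement.overlap_nonneg _ ρ σ,
    polarMeasurement_overlap_lt_one hρ (isState_of_mem_SEP hσ) fun h => hsep (h ▸ hσ),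
    ProductMeasurement.distinguishes_of_SEP hmax⟩

theorem Criterion.IsTensorClosed.exists_distinguishes_pow {C : Criterion} (hC : C.IsTensorClosed)
    {A B : Type} [Fintype A] [Fintype B] {ρ : Matrix (A × B) (A × B) ℂ} (hρ : IsState ρ)
    (hρC : ρ ∈ C A B) {M : ProductMeasurement A B} {β : ℝ} (hβ : 0 ≤ β) (hM : M.Distinguishes ρ β)
    (n : ℕ) : ∃ (A' B' : Type) (_ : Fintype A') (_ : Fintype B')
      (ρ' : Matrix (A' × B') (A' × B') ℂ) (M' : ProductMeasurement A' B'),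
      IsState ρ' ∧ ρ' ∈ C A' B' ∧ M'.Distinguishes ρ' (β ^ (n + 1)) := by
  induction n with
  | zero => exact ⟨A, B, _, _, ρ, M, hρ, hρC, by simpa using hM⟩
  | succ n ih =>
    obtain ⟨A', B', _, _, ρ', M', hρ', hρC', hM'⟩ := ih
    refine ⟨_, _, _, _, bipartiteTensor ρ ρ', M.prod M', hρ.bipartiteTensor hρ',
      hC _ _ _ _ _ _ hρ hρ' hρC hρC', ?_⟩
    rw [pow_succ']
    exact hM.prod hβ hρ hρ' hM'

end

theorem theorem3 (C : Criterion) (hnec : C.IsNecessary) (hsuff : ¬ C.IsSufficient)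
    (htensor : C.IsTensorClosed) (ε : ℝ) (hε : 0 < ε) :
    ∃ (A B : Type) (_ : Fintype A) (_ : Fintype B) (ρ : Matrix (A × B) (A × B) ℂ),
      IsState ρ ∧ ρ ∈ C A B ∧ ∀ σ ∈ SEP A B, 1 - ε ≤ traceDist ρ σ := by
  unfold Criterion.IsSufficient at hsuff
  push Not at hsuff
  obtain ⟨A, B, _, _, ρ, hρ, hρC, hsep⟩ := hsuff
  obtain ⟨β, hβ0, hβ1, hM⟩ := exists_distinguishes hρ hsep
  obtain ⟨n, hn⟩ := exists_pow_lt_of_lt_one hε hβ1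
  obtain ⟨A', B', _, _, ρ', M', hρ', hρC', hM'⟩ := htensor.exists_distinguishes_pow hρ hρC hβ0 hM n
  refine ⟨A', B', _, _, ρ', hρ', hρC', fun σ hσ => ?_⟩
  have h1 := hM' σ (SEP_subset_sepCone hσ)
  rw [trace_of_mem_SEP hσ, Complex.one_re, Real.sqrt_one, mul_one] at h1
  have h2 := M'.one_sub_overlap_le_traceDist hρ' (isState_of_mem_SEP hσ)
  have h3 : β ^ (n + 1) ≤ β ^ n := pow_le_pow_of_le_one hβ0 hβ1.le n.le_succ
  linarith
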